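/- Let $A$ be a (not necessarily unital) $C^*$-algebra that has an irreducible representation $\pi:A\to\mathscr{B}(\mathcal{H})$ on an infinite dimensional complex Hilbert space $\mathcal{H}$ (that is, a non-zero $^*$-homomorphism whose only closed invariant subspaces are $\{0\}$ and $\mathcal{H}$). Then the Lebesgue decomposition of positive functionals over $A$ is not unique. Here a linear functional $f:A\to\mathbb{C}$ is positive if $f(a^*a)\ge 0$ for all $a\in A$, and $f\le g$ means that $g-f$ is positive. For positive functionals $f,g$ we write $f\ll g$ ($f$ is absolutely continuous with respect to $g$) if there are positive functionals $f_n$ and numbers $\alpha_n>0$ with $f_n\le f_{n+1}$ and $f_n\le\alpha_n g$ for all $n\in\mathbb{N}$, and $f_n\to f$ pointwise on $A$; and we write $f\perp g$ if the only positive functional $p'$ with $p'\le f$ and $p'\le g$ is $p'=0$. The Lebesgue decomposition of $f$ with respect to $g$ is $f=f_r+f_s$, where $f_r$ is the greatest of all positive functionals $f_0$ with $f_0\le f$ and $f_0\ll g$, and where the positive functional $f_s=f-f_r$ satisfies $f_s\perp g$ and $f_s\perp f_r$. It is unique if, for all positive functionals $f_r',f_s'$ on $A$, the properties $f=f_r'+f_s'$,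 $f_r'\ll g$ and $f_s'\perp g$ force $f_r'=f_r$ and $f_s'=f_s$. The Lebesgue decomposition of positive functionals over $A$ is unique if this holds for all positive functionals $f,g$ on $A$. Thus the assertion is that there are positive functionals $f,g$ on $A$ with a Lebesgue decomposition $f=f_r+f_s$ of $f$ with respect to $g$, and positive functionals $f_r',f_s'$ on $A$ such that $f=f_r'+f_s'$, $f_r'\ll g$, $f_s'\perp g$ and $(f_r',f_s')\neq(f_r,f_s)$. -/

import Mathlib

open Filter Topology
open scoped ComplexOrder

namespace LebesgueDecomp

section Functionals

variable {A : Type*} [NonUnitalRing A] [StarRing A] [Module ℂ A]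

/-- A linear functional `f : A → ℂ` on a complex star-algebra is positive if `f (a* a) ≥ 0` for
every `a` (the order on `ℂ` is the usual one: `0 ≤ z` says that `z` is a non-negative real). -/
def IsPositive (f : A →ₗ[ℂ] ℂ) : Prop :=
  ∀ a : A, 0 ≤ f (star a * a)

/-- `f ≤ g` for functionals: the difference `g - f` is positive. -/
def Dominated (f g : A →ₗ[ℂ] ℂ) : Prop :=
  IsPositive (g - f)

/-- `f ≪ g`: there are positive functionals `F 0 ≤ F 1 ≤ ...` and positive numbers `α n` with
`F n ≤ α n • g` whose supremum, that is, pointwise limit, is `f`. -/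
def AbsCont (f g : A →ₗ[ℂ] ℂ) : Prop :=
  ∃ (F : ℕ → (A →ₗ[ℂ] ℂ)) (α : ℕ → ℝ),
    (∀ n, IsPositive (F n)) ∧ (∀ n, 0 < α n) ∧
    (∀ n, Dominated (F n) (F (n + 1))) ∧
    (∀ n, Dominated (F n) ((α n : ℂ) • g)) ∧
    ∀ a : A, Tendsto (fun n => F n a) atTop (𝓝 (f a))

/-- `f ⊥ g`: the only positive functional dominated by both `f` and `g` is zero. -/
def Singular (f g : A →ₗ[ℂ] ℂ) : Prop :=
  ∀ p : A →ₗ[ℂ] ℂ, IsPositive p → Dominated p f → Dominated p g → p = 0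

/-- `fr` is the greatest among the positive functionals that are dominated by `f` and absolutely
continuous with respect to `g`. -/
def IsRegularPart (f g fr : A →ₗ[ℂ] ℂ) : Prop :=
  (IsPositive fr ∧ Dominated fr f ∧ AbsCont fr g) ∧
    ∀ f₀ : A →ₗ[ℂ] ℂ, IsPositive f₀ → Dominated f₀ f → AbsCont f₀ g → Dominated f₀ fr

/-- `f = fr + fs` is the Lebesgue decomposition of `f` with respect to `g`, with regular part `fr`
and singular part `fs`. -/
structure IsLebesgueDecomposition (f g fr fs : A →ₗ[ℂ] ℂ) : Prop where
  regular : IsRegularPart f g fr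
  pos_singular : IsPositive fs
  sum_eq : f = fr + fs
  singular_right : Singular fs g
  singular_regular : Singular fs fr

/-- The Lebesgue decomposition `f = fr + fs` of `f` with respect to `g` is unique: every
decomposition of `f` into a positive functional that is absolutely continuous with respect to `g`
and a positive functional that is singular to `g` coincides with it. -/
def DecompositionUnique (f g : A →ₗ[ℂ] ℂ) : Prop :=
  ∀ fr fs : A →ₗ[ℂ] ℂ, IsLebesgueDecomposition f g fr fs →
    ∀ fr' fs' : A →ₗ[ℂ] ℂ, IsPositive fr' → IsPositive fs' →
      f = fr' + fs' → AbsCont fr' g → Singular fs' g → fr' = fr ∧ fs' = fs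

end Functionals

/-- The Lebesgue decomposition of positive functionals over `A` is unique. -/
def LebesgueDecompositionUnique (A : Type*) [NonUnitalRing A] [StarRing A] [Module ℂ A] : Prop :=
  ∀ f g : A →ₗ[ℂ] ℂ, IsPositive f → IsPositive g → DecompositionUnique f g

/-- A representation `π` of `A` on a Hilbert space `H` is (topologically) irreducible if it is
non-zero and its only closed invariant subspaces are `{0}` and `H`. -/
def IsIrreducibleRep {A : Type*} [NonUnitalRing A] [StarRing A] [Module ℂ A]
    {H : Type*} [NormedAddCommGroup H] [InnerProductSpace ℂ H] [CompleteSpace H]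
    (π : A →⋆ₙₐ[ℂ] (H →L[ℂ] H)) : Prop :=
  (∃ a : A, π a ≠ 0) ∧
    ∀ K : Submodule ℂ H, IsClosed (K : Set H) → (∀ a : A, ∀ x ∈ K, π a x ∈ K) → K = ⊥ ∨ K = ⊤

end LebesgueDecomp

/-!
Let `e 0, e 1, …` be an orthonormal sequence in `H` and let `δ n > 0` with `∑ (δ n) ^ 2 = 1`. Write
`ω x` for the vector functional `a ↦ ⟪x, π(a) x⟫`. Non-uniqueness occurs for
`g = ∑ (δ n) ^ 4 • ω (e n)` and `f = ∑ (δ n) ^ 2 • ω (e n)`; both are vector functionals of the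
amplification of `π` to `ℓ²(ℕ, H)`.

The partial sums of `f` are dominated by multiples of `g`, so `f ≪ g` and the Lebesgue decomposition
of `f` is `f = f + 0`. A second decomposition is `f = (f - ω v) + ω v` with
`v = ∑ (δ n) ^ 2 • e n`.

* `f - ω v ≪ g` (`isPositive_and_absCont_sub`). In terms of density operators on the closed span of
  the `e n`, `f - ω v` is `D ^ (1/2) (1 - P) D ^ (1/2)`, where `D` is diagonal with entries
  `(δ n) ^ 2` and `P` is the projection onto the unit vector `x = ∑ δ n • e n`. The projection
  `1 - P` is the supremum of the projections onto the vectors in the span of `e 0, …, e (n - 1)`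
  that are orthogonal to `x`. The resulting functionals are written down explicitly, and that they
  increase is an instance of the Cauchy–Schwarz inequality.
* `ω v ⊥ g` (`IsIrreducibleRep.singular_vectorFunctional`). In terms of density operators, `v` is
  not in the range of the square root of the density of `g`, since its preimage would have all
  coordinates equal to one. To transfer this to `A`, let `p` be a functional below `ω v` and `g`.
  Its GNS space receives intertwiners from `H` and from `ℓ²(ℕ, H)` (`exists_intertwiner`), and
  composing them with adjoints gives operators in the commutant of `π`, which are scalars
  by Schur's lemma (`IsIrreducibleRep.exists_smul`). This determines them, and one obtains a
  square-summable sequence of vectors of constant norm, which forces `p = 0`.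
-/

namespace LebesgueDecomp

/-! ### Positive functionals -/

section Order

universe u

variable {A : Type u} [NonUnitalCStarAlgebra A]

/-- The squares `a* a` span a C⋆-algebra, so a functional is determined by its values on them. -/
theorem eq_zero_of_forall_star_mul_self {f : A →ₗ[ℂ] ℂ} (h : ∀ a, f (star a * a) = 0) :
    f = 0 := by
  let _ := CStarAlgebra.spectralOrder A
  have := CStarAlgebra.spectralOrderedRing A
  refine LinearMap.ext_on (CStarAlgebra.span_nonneg (A := A)) fun x hx => ?_
  obtain ⟨b, rfl⟩ := CStarAlgebra.nonneg_iff_eq_star_mul_self.1 (show 0 ≤ x from hx)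
  simpa using h b

/-- A positive functional, presented through its GNS representation `σ` on a Hilbert space `K`:
the map `Λ` sends `a` to its class in `K`. -/
theorem IsPositive.exists_gns {p : A →ₗ[ℂ] ℂ} (hp : IsPositive p) :
    ∃ (K : Type u) (_ : NormedAddCommGroup K) (_ : InnerProductSpace ℂ K) (_ : CompleteSpace K)
      (σ : A →⋆ₙₐ[ℂ] (K →L[ℂ] K)) (Λ : A →ₗ[ℂ] K),
      (∀ a b, Λ (a * b) = σ a (Λ b)) ∧ ∀ a, p (star a * a) = ((‖Λ a‖ ^ 2 : ℝ) : ℂ) := by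
  let _ := CStarAlgebra.spectralOrder A
  have := CStarAlgebra.spectralOrderedRing A
  let f : A →ₚ[ℂ] ℂ := PositiveLinearMap.mk₀ p fun x hx => by
    obtain ⟨b, rfl⟩ := CStarAlgebra.nonneg_iff_eq_star_mul_self.1 hx
    exact hp b
  refine ⟨f.GNS, inferInstance, inferInstance, inferInstance, f.gnsNonUnitalStarAlgHom,
    (UniformSpace.Completion.toComplₗᵢ (𝕜 := ℂ) (E := f.PreGNS)).toLinearMap ∘ₗ
      f.toPreGNS.toLinearMap, fun a b => ?_, fun a => ?_⟩
  · simp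
  · have := f.preGNS_norm_sq (f.toPreGNS a)
    simp only [LinearMap.coe_comp, Function.comp_apply, LinearIsometry.coe_toLinearMap,
      LinearEquiv.coe_coe, UniformSpace.Completion.coe_toComplₗᵢ, UniformSpace.Completion.norm_coe]
    rw [Complex.ofReal_pow, this]
    rfl

end Order

/-! ### Vector functionals -/

section Vector

variable {A : Type*} [NonUnitalRing A] [StarRing A] [Module ℂ A]
  {H : Type*} [NormedAddCommGroup H] [InnerProductSpace ℂ H] [CompleteSpace H]

/-- The vector functional `a ↦ ⟪ξ, π(a) ξ⟫`. -/
noncomputable def vectorFunctional (π : A →⋆ₙₐ[ℂ] (H →L[ℂ] H)) (ξ : H) : A →ₗ[ℂ] ℂ where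
  toFun a := inner ℂ ξ (π a ξ)
  map_add' a b := by simp
  map_smul' c a := by simp

theorem vectorFunctional_apply (π : A →⋆ₙₐ[ℂ] (H →L[ℂ] H)) (ξ : H) (a : A) :
    vectorFunctional π ξ a = inner ℂ ξ (π a ξ) := rfl

theorem inner_star_apply (π : A →⋆ₙₐ[ℂ] (H →L[ℂ] H)) (a : A) (x y : H) :
    inner ℂ (π (star a) x) y = inner ℂ x (π a y) := by
  rw [map_star, ContinuousLinearMap.star_eq_adjoint, ContinuousLinearMap.adjoint_inner_left]

theorem vectorFunctional_star_mul_self (π : A →⋆ₙₐ[ℂ] (H →L[ℂ] H)) (ξ : H) (a : A) :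
    vectorFunctional π ξ (star a * a) = ((‖π a ξ‖ ^ 2 : ℝ) : ℂ) := by
  rw [vectorFunctional_apply, map_mul, mul_apply_eq_comp, ← inner_star_apply π,
    star_star, inner_self_eq_norm_sq_to_K]
  simp

theorem isPositive_vectorFunctional (π : A →⋆ₙₐ[ℂ] (H →L[ℂ] H)) (ξ : H) :
    IsPositive (vectorFunctional π ξ) := fun a => by
  rw [vectorFunctional_star_mul_self]
  exact Complex.zero_le_real.2 (sq_nonneg _)

end Vector

/-! ### The amplification of a representation to `ℓ²(ℕ, H)` -/

section Amplify

variable {A : Type*} [NonUnitalRing A] [StarRing A] [Module ℂ A]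
  {H : Type*} [NormedAddCommGroup H] [InnerProductSpace ℂ H] [CompleteSpace H]

/-- The countable multiple of the representation `π`, acting coordinatewise on `ℓ²(ℕ, H)`. -/
noncomputable def amplify (π : A →⋆ₙₐ[ℂ] (H →L[ℂ] H)) :
    A →⋆ₙₐ[ℂ] (lp (fun _ : ℕ => H) 2 →L[ℂ] lp (fun _ : ℕ => H) 2) where
  toFun a := lp.mapCLM 2 (fun _ => π a) (norm_nonneg (π a)) fun _ => le_rfl
  map_smul' c a := by ext; simp
  map_zero' := by ext; simp
  map_add' a b := by ext; simp
  map_mul' a b := by ext; simp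
  map_star' a := by
    rw [ContinuousLinearMap.star_eq_adjoint, ContinuousLinearMap.eq_adjoint_iff]
    intro x y
    simp only [lp.inner_eq_tsum, lp.mapCLM_apply_coe, inner_star_apply]

@[simp]
theorem amplify_apply (π : A →⋆ₙₐ[ℂ] (H →L[ℂ] H)) (a : A) (x : lp (fun _ : ℕ => H) 2) (n : ℕ) :
    amplify π a x n = π a (x n) := rfl

theorem hasSum_vectorFunctional_amplify (π : A →⋆ₙₐ[ℂ] (H →L[ℂ] H))
    (ξ : lp (fun _ : ℕ => H) 2) (a : A) :
    HasSum (fun n => vectorFunctional π (ξ n) a) (vectorFunctional (amplify π) ξ a) :=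
  lp.hasSum_inner ξ (amplify π a ξ)

theorem norm_sq_le_norm_amplify_sq (π : A →⋆ₙₐ[ℂ] (H →L[ℂ] H)) (ξ : lp (fun _ : ℕ => H) 2)
    (a : A) (s : Finset ℕ) : ∑ n ∈ s, ‖π a (ξ n)‖ ^ 2 ≤ ‖amplify π a ξ‖ ^ 2 := by
  have := lp.hasSum_norm (p := 2) (by norm_num) (amplify π a ξ)
  simp only [ENNReal.toReal_ofNat, Real.rpow_ofNat, amplify_apply] at this
  exact sum_le_hasSum s (fun _ _ => sq_nonneg _) this

end Amplify

/-! ### Intertwiners -/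

section Intertwiner

variable {A : Type*} [NonUnitalRing A] [StarRing A] [Module ℂ A]
  {K : Type*} [NormedAddCommGroup K] [InnerProductSpace ℂ K] [CompleteSpace K]
  {K' : Type*} [NormedAddCommGroup K'] [InnerProductSpace ℂ K'] [CompleteSpace K']

/-- If `‖Λ' a‖ ≤ ‖Λ a‖` for two equivariant maps from `A`, then `Λ a ↦ Λ' a` extends to a bounded
intertwiner: by continuity to the closure of the range of `Λ`, and by zero to its orthogonal
complement, which is invariant too. -/
theorem exists_intertwiner (σ : A →⋆ₙₐ[ℂ] (K →L[ℂ] K)) (σ' : A →⋆ₙₐ[ℂ] (K' →L[ℂ] K'))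
    (Λ : A →ₗ[ℂ] K) (Λ' : A →ₗ[ℂ] K') (hΛ : ∀ a b, Λ (a * b) = σ a (Λ b))
    (hΛ' : ∀ a b, Λ' (a * b) = σ' a (Λ' b)) (hle : ∀ a, ‖Λ' a‖ ≤ ‖Λ a‖) :
    ∃ T : K →L[ℂ] K', (∀ a, T (Λ a) = Λ' a) ∧ ∀ a x, T (σ a x) = σ' a (T x) := by
  let M : Submodule ℂ K := (LinearMap.range Λ).topologicalClosure
  have hM (a) : Λ a ∈ M := Submodule.le_topologicalClosure _ ⟨a, rfl⟩
  have : CompleteSpace M := (Submodule.isClosed_topologicalClosure _).completeSpace_coe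
  let e : A →ₗ[ℂ] M := Λ.codRestrict M hM
  have he : DenseRange e := by
    rw [DenseRange, Subtype.dense_iff]
    intro x hx
    rw [← Set.range_comp]
    exact hx
  let T : K →L[ℂ] K' := (Λ'.extendOfNorm e).comp M.orthogonalProjectionOnto
  have hT (a) : T (Λ a) = Λ' a := by
    have h1 : M.orthogonalProjectionOnto (Λ a) = e a :=
      Submodule.orthogonalProjectionOnto_mem_subspace_eq_self (e a)
    simp only [T, ContinuousLinearMap.comp_apply, h1]
    exact LinearMap.extendOfNorm_eq he ⟨1, fun x => (hle x).trans_eq (one_mul _).symm⟩ a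
  have hinv (a) : ∀ x ∈ M, σ a x ∈ M := by
    intro x hx
    refine closure_minimal (t := σ a ⁻¹' M) ?_
      ((Submodule.isClosed_topologicalClosure _).preimage (σ a).continuous) hx
    rintro _ ⟨b, rfl⟩
    rw [Set.mem_preimage, ← hΛ]
    exact hM (a * b)
  have hinv' (a) : ∀ x ∈ Mᗮ, σ a x ∈ Mᗮ := by
    intro x hx y hy
    rw [← inner_star_apply σ]
    exact hx _ (hinv _ y hy)
  have hT0 : ∀ x ∈ Mᗮ, T x = 0 := fun x hx => by
    simp [T, Submodule.orthogonalProjectionOnto_apply_of_mem_orthogonal hx]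
  refine ⟨T, hT, fun a x => ?_⟩
  obtain ⟨y, hy, z, hz, rfl⟩ := M.exists_add_mem_mem_orthogonal x
  have hyT : T (σ a y) = σ' a (T y) := by
    refine closure_minimal (t := {y | T (σ a y) = σ' a (T y)}) ?_
      (isClosed_eq (by fun_prop) (by fun_prop)) hy
    rintro _ ⟨b, rfl⟩
    simp only [Set.mem_ofPred_eq, ← hΛ, hT, hΛ']
  simp [hyT, hT0 z hz, hT0 _ (hinv' a z hz)]

/-- The adjoint of an intertwiner is an intertwiner. -/
theorem adjoint_intertwines {σ : A →⋆ₙₐ[ℂ] (K →L[ℂ] K)} {σ' : A →⋆ₙₐ[ℂ] (K' →L[ℂ] K')}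
    {T : K →L[ℂ] K'} (hT : ∀ a x, T (σ a x) = σ' a (T x)) (a : A) (y : K') :
    T.adjoint (σ' a y) = σ a (T.adjoint y) := by
  refine ext_inner_right ℂ fun x => ?_
  rw [ContinuousLinearMap.adjoint_inner_left, ← star_star a, inner_star_apply, ← hT,
    inner_star_apply, ContinuousLinearMap.adjoint_inner_left]

end Intertwiner

/-! ### Irreducible representations -/

section Irreducible

variable {A : Type*} [NonUnitalRing A] [StarRing A] [Module ℂ A]
  {H : Type*} [NormedAddCommGroup H] [InnerProductSpace ℂ H] [CompleteSpace H]
  {π : A →⋆ₙₐ[ℂ] (H →L[ℂ] H)}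

/-- An irreducible representation is nondegenerate. -/
theorem IsIrreducibleRep.eq_zero_of_forall (hπ : IsIrreducibleRep π) {x : H}
    (hx : ∀ a, π a x = 0) : x = 0 := by
  let N : Submodule ℂ H := ⨅ a, LinearMap.ker (π a).toLinearMap
  have hN (y : H) : y ∈ N ↔ ∀ a, π a y = 0 := by simp [N]
  have hcl : IsClosed (N : Set H) := by
    have : (N : Set H) = ⋂ a, {y | π a y = 0} := by ext y; simp [hN]
    rw [this]
    exact isClosed_iInter fun a => isClosed_eq (π a).continuous continuous_const
  rcases hπ.2 N hcl fun a y hy => by simp [(hN y).1 hy a] with h | h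
  · simpa [h] using (hN x).2 hx
  · obtain ⟨a, ha⟩ := hπ.1
    refine absurd (ContinuousLinearMap.ext fun y => ?_) ha
    exact (hN y).1 (h ▸ Submodule.mem_top) a

/-- If `S` is not zero and commutes with an irreducible representation then it is injective. -/
theorem IsIrreducibleRep.injective_of_commute (hπ : IsIrreducibleRep π) {S : H →L[ℂ] H}
    (hS : ∀ a, Commute S (π a)) (h0 : S ≠ 0) {x : H} (hx : S x = 0) : x = 0 := by
  rcases hπ.2 (LinearMap.ker S.toLinearMap) (by exact S.isClosed_ker) (fun a y hy => by
    have := DFunLike.congr_fun (hS a).eq y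
    simp only [LinearMap.mem_ker, ContinuousLinearMap.coe_coe] at hy ⊢
    simpa [hy] using this) with h | h
  · have : x ∈ LinearMap.ker S.toLinearMap := hx
    simpa [h] using this
  · exact absurd (ContinuousLinearMap.ext fun y => LinearMap.congr_fun (LinearMap.ker_eq_top.1 h) y)
      h0

/-- Schur's lemma for self-adjoint operators: if the spectrum had two points `r < t`, the
functional calculus would give two non-zero operators with product zero in the commutant. -/
theorem IsIrreducibleRep.exists_real_smul_of_isSelfAdjoint (hπ : IsIrreducibleRep π)
    {S : H →L[ℂ] H} (hsa : IsSelfAdjoint S) (hS : ∀ a, Commute S (π a)) :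
    ∃ c : ℝ, S = algebraMap ℝ (H →L[ℂ] H) c := by
  have key : ∀ r ∈ spectrum ℝ S, ∀ t ∈ spectrum ℝ S, ¬ r < t := by
    intro r hr t ht hrt
    let m := (r + t) / 2
    -- `f` vanishes to the right of the midpoint `m` and `g` to the left of it.
    let f : ℝ → ℝ := fun x => max (m - x) 0
    let g : ℝ → ℝ := fun x => max (x - m) 0
    have hf : Continuous f := by fun_prop
    have hg : Continuous g := by fun_prop
    have hfg : cfc f S * cfc g S = 0 := by
      rw [← cfc_mul f g S hf.continuousOn hg.continuousOn]
      have : (fun x => f x * g x) = fun _ => 0 := by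
        funext x
        rcases le_total x m with h | h
        · simp [g, h]
        · simp [f, h]
      rw [this, cfc_const_zero]
    have hne {h : ℝ → ℝ} (hc : Continuous h) {u : ℝ} (hu : u ∈ spectrum ℝ S) (h0 : h u ≠ 0) :
        cfc h S ≠ 0 := by
      intro hz
      have : h u ∈ spectrum ℝ (cfc h S) := by
        rw [cfc_map_spectrum h S hsa hc.continuousOn]
        exact ⟨u, hu, rfl⟩
      rw [hz] at this
      by_cases hn : Nontrivial (H →L[ℂ] H)
      · rw [spectrum.zero_eq] at this
        exact h0 this
      · rw [not_nontrivial_iff_subsingleton] at hn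
        simp [spectrum.of_subsingleton] at this
    refine hne hg ht (by simp [g, m]; linarith) (ContinuousLinearMap.ext fun x => ?_)
    refine hπ.injective_of_commute (fun a => (hS a).cfc_real f)
      (hne hf hr (by simp [f, m]; linarith)) ?_
    exact DFunLike.congr_fun hfg x
  rcases (spectrum ℝ S).eq_empty_or_nonempty with h | ⟨r, hr⟩
  · exact ⟨0, CFC.eq_algebraMap_of_spectrum_subset_singleton S 0 (by simp [h])⟩
  · refine ⟨r, CFC.eq_algebraMap_of_spectrum_subset_singleton S r fun t ht => ?_⟩
    exact le_antisymm (not_lt.1 (key r hr t ht)) (not_lt.1 (key t ht r hr))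

/-- Schur's lemma: the commutant of an irreducible representation consists of scalars. -/
theorem IsIrreducibleRep.exists_smul (hπ : IsIrreducibleRep π) {S : H →L[ℂ] H}
    (hS : ∀ a x, S (π a x) = π a (S x)) : ∃ c : ℂ, ∀ x, S x = c • x := by
  have h1 (a) : Commute S (π a) := ContinuousLinearMap.ext (hS a)
  have h2 (a) : Commute (star S) (π a) := by
    have := (h1 (star a)).star_star
    rwa [map_star, star_star] at this
  obtain ⟨r, hr⟩ := hπ.exists_real_smul_of_isSelfAdjoint (realPart S).2 fun a => by
    rw [realPart_apply_coe]
    exact ((h1 a).add_left (h2 a)).smul_left _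
  obtain ⟨t, ht⟩ := hπ.exists_real_smul_of_isSelfAdjoint (imaginaryPart S).2 fun a => by
    rw [imaginaryPart_apply_coe]
    exact (((h1 a).sub_left (h2 a)).smul_left _).smul_left _
  refine ⟨r + Complex.I * t, fun x => ?_⟩
  conv_lhs => rw [← realPart_add_I_smul_imaginaryPart S, hr, ht]
  simp [Algebra.algebraMap_eq_smul_one, add_smul, mul_smul]

end Irreducible


/-! ### Singular vector functionals -/

section Singular

variable {A : Type*} [NonUnitalCStarAlgebra A]
  {H : Type*} [NormedAddCommGroup H] [InnerProductSpace ℂ H] [CompleteSpace H]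
  {π : A →⋆ₙₐ[ℂ] (H →L[ℂ] H)}

/-- If `p ≤ ⟪ξ, σ(·) ξ⟫` and `K` is the GNS space of `p`, then there is an intertwiner into `K`
sending `σ(a) ξ` to the class of `a`. -/
theorem exists_intertwiner_of_dominated {K L : Type*}
    [NormedAddCommGroup K] [InnerProductSpace ℂ K] [CompleteSpace K]
    [NormedAddCommGroup L] [InnerProductSpace ℂ L] [CompleteSpace L]
    (σ : A →⋆ₙₐ[ℂ] (L →L[ℂ] L)) (ξ : L) {p : A →ₗ[ℂ] ℂ}
    {ρ : A →⋆ₙₐ[ℂ] (K →L[ℂ] K)} {Λ : A →ₗ[ℂ] K} (hΛ : ∀ a b, Λ (a * b) = ρ a (Λ b))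
    (hp : ∀ a, p (star a * a) = ((‖Λ a‖ ^ 2 : ℝ) : ℂ))
    (hle : Dominated p (vectorFunctional σ ξ)) :
    ∃ T : L →L[ℂ] K, (∀ a, T (σ a ξ) = Λ a) ∧ ∀ a x, T (σ a x) = ρ a (T x) := by
  let Λ₀ : A →ₗ[ℂ] L :=
    { toFun := fun a => σ a ξ
      map_add' := fun a b => by simp
      map_smul' := fun c a => by simp }
  refine exists_intertwiner σ ρ Λ₀ Λ (fun a b => by simp [Λ₀]) hΛ fun a => ?_
  have h := hle a
  rw [LinearMap.sub_apply, sub_nonneg, hp, vectorFunctional_star_mul_self,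
    Complex.real_le_real] at h
  exact (sq_le_sq₀ (norm_nonneg _) (norm_nonneg _)).1 h

theorem _root_.Orthonormal.inner_eq_of_hasSum {E : Type*} [NormedAddCommGroup E]
    [InnerProductSpace ℂ E] {e : ℕ → E} (he : Orthonormal ℂ e) {c : ℕ → ℂ} {v : E}
    (hv : HasSum (fun n => c n • e n) v) (n : ℕ) : inner ℂ (e n) v = c n := by
  refine ((hv.mapL (innerSL ℂ (e n))).unique (hasSum_single n fun k hk => ?_)).trans ?_
  · simp [orthonormal_iff_ite.1 he, hk.symm]
  · simp [he.1]

/-- Let `η = (c₀ e₀, c₁ e₁, …)` and `v = ∑ cₙ eₙ`. A functional `p` below both vector functionals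
yields intertwiners `T : H → K` and `W : ℓ²(ℕ, H) → K` to its GNS space. By Schur's lemma
`T* T` is a scalar `t`, and `Q = W* T` has scalar coordinates; comparing inner products with `η`
shows that all of them equal `t` up to conjugation. As `Q x` is square summable, `t = 0`. -/
theorem IsIrreducibleRep.singular_vectorFunctional (hπ : IsIrreducibleRep π) {e : ℕ → H}
    (he : Orthonormal ℂ e) {c : ℕ → ℂ} (hc : ∀ n, c n ≠ 0) {η : lp (fun _ : ℕ => H) 2}
    (hη : ∀ n, η n = c n • e n) {v : H} (hv : HasSum (fun n => η n) v) :
    Singular (vectorFunctional π v) (vectorFunctional (amplify π) η) := by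
  intro p hp hpv hpη
  obtain ⟨K, _, _, _, ρ, Λ, hΛ, hpΛ⟩ := hp.exists_gns
  obtain ⟨T, hT, hTρ⟩ := exists_intertwiner_of_dominated π v hΛ hpΛ hpv
  obtain ⟨W, hW, hWρ⟩ := exists_intertwiner_of_dominated (amplify π) η hΛ hpΛ hpη
  obtain ⟨t, ht⟩ := hπ.exists_smul (S := T.adjoint.comp T) fun a x => by
    simp [hTρ, adjoint_intertwines hTρ]
  replace ht (x) : T.adjoint (T x) = t • x := ht x
  have hQ (n : ℕ) : ∃ w : ℂ, ∀ x, (W.adjoint (T x)) n = w • x :=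
    hπ.exists_smul (S := (lp.evalCLM ℂ (fun _ : ℕ => H) 2 n).comp (W.adjoint.comp T)) fun a x => by
      change (W.adjoint (T (π a x))) n = π a ((W.adjoint (T x)) n)
      rw [hTρ, adjoint_intertwines hWρ, amplify_apply]
  choose w hw using hQ
  have hTW : T.adjoint (W η) = t • v := by
    refine sub_eq_zero.1 (hπ.eq_zero_of_forall fun a => ?_)
    rw [map_sub, ← adjoint_intertwines hTρ, ← hWρ, hW, map_smul, ← map_smul (π a), sub_eq_zero,
      ← hT, ht, map_smul]
  have hev (n : ℕ) : inner ℂ (e n) v = c n := he.inner_eq_of_hasSum (by simpa only [hη] using hv) n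
  have hwt (n : ℕ) : star (w n) = t := by
    have h1 : inner ℂ (W.adjoint (T (e n))) η = t * c n := by
      rw [ContinuousLinearMap.adjoint_inner_left, ← ContinuousLinearMap.adjoint_inner_right, hTW,
        inner_smul_right, hev]
    have h2 : inner ℂ (W.adjoint (T (e n))) η = star (w n) * c n := by
      refine ((lp.hasSum_inner _ _).unique (hasSum_single n fun k hk => ?_)).trans ?_
      · simp [hw, hη, inner_smul_left, inner_smul_right, orthonormal_iff_ite.1 he, hk.symm]
      · simp [hw, hη, inner_smul_left, inner_smul_right, he.1, mul_comm]
    exact mul_right_cancel₀ (hc n) (h2.symm.trans h1)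
  have ht0 : t = 0 := by
    have h1 := (lp.hasSum_norm (p := 2) (by norm_num)
      (W.adjoint (T (e 0)))).summable.tendsto_atTop_zero
    have h2 (n : ℕ) : ‖(W.adjoint (T (e 0))) n‖ = ‖t‖ := by
      rw [hw, norm_smul, he.1 0, mul_one, ← hwt n, norm_star]
    simp only [h2, ENNReal.toReal_ofNat, Real.rpow_ofNat] at h1
    simpa using tendsto_nhds_unique tendsto_const_nhds h1
  refine eq_zero_of_forall_star_mul_self fun a => ?_
  have : T (π a v) = 0 := by
    rw [← inner_self_eq_zero (𝕜 := ℂ), ← ContinuousLinearMap.adjoint_inner_left, ht, ht0]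
    simp
  simp [hpΛ, ← hT, this]

end Singular

/-! ### Absolutely continuous functionals -/

section AbsCont

variable {A : Type*} [NonUnitalRing A] [StarRing A] [Module ℂ A]

theorem Dominated.trans {f g h : A →ₗ[ℂ] ℂ} (h₁ : Dominated f g) (h₂ : Dominated g h) :
    Dominated f h := fun a => by
  have := add_nonneg (h₁ a) (h₂ a)
  simpa using this

theorem isPositive_of_tendsto {F : ℕ → A →ₗ[ℂ] ℂ} {f : A →ₗ[ℂ] ℂ} (hF : ∀ n, IsPositive (F n))
    (hf : ∀ a, Tendsto (fun n => F n a) atTop (𝓝 (f a))) : IsPositive f := fun a =>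
  ge_of_tendsto' (hf _) fun n => hF n a

/-- A form of the Cauchy–Schwarz inequality: the function `(x, s) ↦ ‖x‖² / s` is subadditive. -/
theorem norm_add_sq_div_le {E : Type*} [SeminormedAddCommGroup E] (x y : E) {s t : ℝ}
    (hs : 0 < s) (ht : 0 < t) :
    (s + t)⁻¹ * ‖x + y‖ ^ 2 ≤ s⁻¹ * ‖x‖ ^ 2 + t⁻¹ * ‖y‖ ^ 2 := by
  have h1 : ‖x + y‖ ^ 2 ≤ (‖x‖ + ‖y‖) ^ 2 := by
    gcongr
    exact norm_add_le x y
  refine (mul_le_mul_of_nonneg_left h1 (by positivity)).trans ?_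
  rw [← sub_nonneg]
  have : s⁻¹ * ‖x‖ ^ 2 + t⁻¹ * ‖y‖ ^ 2 - (s + t)⁻¹ * (‖x‖ + ‖y‖) ^ 2
      = (t * ‖x‖ - s * ‖y‖) ^ 2 / (s * t * (s + t)) := by
    field_simp
    ring
  rw [this]
  positivity

variable {H : Type*} [NormedAddCommGroup H] [InnerProductSpace ℂ H] [CompleteSpace H]
  (π : A →⋆ₙₐ[ℂ] (H →L[ℂ] H))

/-- The functional of the truncation of `ξ ∈ ℓ²(ℕ, H)` to its first `n` coordinates. -/
noncomputable def truncation (ξ : lp (fun _ : ℕ => H) 2) (n : ℕ) : A →ₗ[ℂ] ℂ :=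
  ∑ k ∈ Finset.range n, vectorFunctional π (ξ k)

theorem truncation_star_mul_self (ξ : lp (fun _ : ℕ => H) 2) (n : ℕ) (a : A) :
    truncation π ξ n (star a * a) = ((∑ k ∈ Finset.range n, ‖π a (ξ k)‖ ^ 2 : ℝ) : ℂ) := by
  simp [truncation, LinearMap.sum_apply, vectorFunctional_star_mul_self]

theorem truncation_succ_sub (ξ : lp (fun _ : ℕ => H) 2) (n : ℕ) :
    truncation π ξ (n + 1) - truncation π ξ n = vectorFunctional π (ξ n) := by
  simp [truncation, Finset.sum_range_succ]

theorem isPositive_truncation (ξ : lp (fun _ : ℕ => H) 2) (n : ℕ) :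
    IsPositive (truncation π ξ n) := fun a => by
  rw [truncation_star_mul_self]
  exact Complex.zero_le_real.2 (Finset.sum_nonneg fun _ _ => sq_nonneg _)

theorem tendsto_truncation (ξ : lp (fun _ : ℕ => H) 2) (a : A) :
    Tendsto (fun n => truncation π ξ n a) atTop (𝓝 (vectorFunctional (amplify π) ξ a)) := by
  simpa [truncation, LinearMap.sum_apply] using
    (hasSum_vectorFunctional_amplify π ξ a).tendsto_sum_nat

variable {ξ η : lp (fun _ : ℕ => H) 2} {δ : ℕ → ℝ}

/-- Each truncation of `ξ` involves finitely many coordinates, each a multiple of one of `η`. -/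
theorem exists_truncation_dominated (hδ : ∀ n, 0 < δ n) (hη : ∀ n, η n = (δ n : ℂ) • ξ n) (n : ℕ) :
    ∃ α : ℝ, 0 < α ∧ Dominated (truncation π ξ n) ((α : ℂ) • vectorFunctional (amplify π) η) := by
  refine ⟨1 + ∑ k ∈ Finset.range n, (δ k ^ 2)⁻¹,
    add_pos_of_pos_of_nonneg one_pos (Finset.sum_nonneg fun k _ => by positivity), fun a => ?_⟩
  rw [LinearMap.sub_apply, LinearMap.smul_apply, vectorFunctional_star_mul_self,
    truncation_star_mul_self, smul_eq_mul, ← Complex.ofReal_mul, sub_nonneg, Complex.real_le_real,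
    add_mul, one_mul, Finset.sum_mul]
  refine le_add_of_nonneg_of_le (sq_nonneg _) (Finset.sum_le_sum fun k _ => ?_)
  have h1 := norm_sq_le_norm_amplify_sq π η a {k}
  rw [Finset.sum_singleton, hη, map_smul, norm_smul, Complex.norm_real, mul_pow, Real.norm_eq_abs,
    sq_abs] at h1
  have := hδ k
  rw [inv_mul_eq_div, le_div_iff₀ (by positivity), mul_comm]
  exact h1

theorem absCont_vectorFunctional_amplify (hδ : ∀ n, 0 < δ n) (hη : ∀ n, η n = (δ n : ℂ) • ξ n) :
    AbsCont (vectorFunctional (amplify π) ξ) (vectorFunctional (amplify π) η) := by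
  choose α hα hdom using exists_truncation_dominated π hδ hη
  refine ⟨truncation π ξ, α, isPositive_truncation π ξ, hα, fun n => ?_, hdom,
    tendsto_truncation π ξ⟩
  rw [Dominated, truncation_succ_sub]
  exact isPositive_vectorFunctional π _

/-- With `ηₙ = δₙ ξₙ`, `v = ∑ ηₙ` and `∑ δₙ² = 1`, the functional of `ξ` minus that of `v` is
positive and absolutely continuous with respect to that of `η`. It is the limit of its compressions
to the first `n` coordinates, in which `v` is replaced by its `n`-th partial sum, divided by
the square root of the `n`-th partial sum of `∑ δₖ²`; these are increasing by
`norm_add_sq_div_le`. -/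
theorem isPositive_and_absCont_sub (hδ : ∀ n, 0 < δ n) (hη : ∀ n, η n = (δ n : ℂ) • ξ n)
    (h1 : HasSum (fun n => δ n ^ 2) 1) {v : H} (hv : HasSum (fun n => η n) v) :
    IsPositive (vectorFunctional (amplify π) ξ - vectorFunctional π v) ∧
      AbsCont (vectorFunctional (amplify π) ξ - vectorFunctional π v)
        (vectorFunctional (amplify π) η) := by
  let s : ℕ → ℝ := fun n => ∑ k ∈ Finset.range n, δ k ^ 2
  let u : ℕ → H := fun n => ∑ k ∈ Finset.range n, η k
  let F : ℕ → A →ₗ[ℂ] ℂ := fun n =>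
    truncation π ξ (n + 1) - (((s (n + 1))⁻¹ : ℝ) : ℂ) • vectorFunctional π (u (n + 1))
  have hs (n) : 0 < s (n + 1) :=
    Finset.sum_pos (fun k _ => pow_pos (hδ k) 2) Finset.nonempty_range_add_one
  have hnorm (a : A) (n : ℕ) : (δ n ^ 2)⁻¹ * ‖π a (η n)‖ ^ 2 = ‖π a (ξ n)‖ ^ 2 := by
    have := hδ n
    rw [hη, map_smul, norm_smul, Complex.norm_real, mul_pow, Real.norm_eq_abs, sq_abs]
    field_simp
  -- The first compression vanishes, as `u 1` is a multiple of `ξ 0`.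
  have hF0 : IsPositive (F 0) := fun a => by
    rw [LinearMap.sub_apply, LinearMap.smul_apply, vectorFunctional_star_mul_self,
      truncation_star_mul_self, smul_eq_mul, ← Complex.ofReal_mul, sub_nonneg,
      Complex.real_le_real]
    simp [s, u, hnorm]
  have hmono (n) : Dominated (F n) (F (n + 1)) := fun a => by
    have key := norm_add_sq_div_le (π a (u (n + 1))) (π a (η (n + 1))) (hs n)
      (pow_pos (hδ (n + 1)) 2)
    rw [hnorm, ← map_add] at key
    have h2 : F (n + 1) - F n = vectorFunctional π (ξ (n + 1))
        - (((s (n + 2))⁻¹ : ℝ) : ℂ) • vectorFunctional π (u (n + 2))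
        + (((s (n + 1))⁻¹ : ℝ) : ℂ) • vectorFunctional π (u (n + 1)) := by
      rw [← truncation_succ_sub π ξ (n + 1)]
      simp only [F]
      abel
    rw [h2, LinearMap.add_apply, LinearMap.sub_apply, LinearMap.smul_apply, LinearMap.smul_apply]
    simp only [vectorFunctional_star_mul_self, smul_eq_mul, ← Complex.ofReal_mul,
      ← Complex.ofReal_sub, ← Complex.ofReal_add]
    rw [Complex.zero_le_real]
    have h3 : s (n + 2) = s (n + 1) + δ (n + 1) ^ 2 := Finset.sum_range_succ _ _
    have h4 : u (n + 2) = u (n + 1) + η (n + 1) := Finset.sum_range_succ _ _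
    rw [h3, h4]
    linarith
  have hpos (n) : IsPositive (F n) := by
    induction n with
    | zero => exact hF0
    | succ n ih =>
      intro a
      have := add_nonneg (ih a) (hmono n a)
      simpa using this
  have hlim (a : A) : Tendsto (fun n => F n a) atTop
      (𝓝 ((vectorFunctional (amplify π) ξ - vectorFunctional π v) a)) := by
    have hs1 : Tendsto (fun n => (((s (n + 1))⁻¹ : ℝ) : ℂ)) atTop (𝓝 1) := by
      have : Tendsto (fun n => (s (n + 1))⁻¹) atTop (𝓝 (1 : ℝ)) := by
        simpa using ((tendsto_add_atTop_iff_nat 1).2 h1.tendsto_sum_nat).inv₀ one_ne_zero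
      exact_mod_cast (Complex.continuous_ofReal.tendsto 1).comp this
    have hu : Tendsto (fun n => u (n + 1)) atTop (𝓝 v) :=
      (tendsto_add_atTop_iff_nat 1).2 hv.tendsto_sum_nat
    have hω : Tendsto (fun n => vectorFunctional π (u (n + 1)) a) atTop
        (𝓝 (vectorFunctional π v a)) :=
      hu.inner (((π a).continuous.tendsto v).comp hu)
    simpa [F] using
      ((tendsto_add_atTop_iff_nat 1).2 (tendsto_truncation π ξ a)).sub (hs1.mul hω)
  choose α hα hdom using exists_truncation_dominated π hδ hη
  refine ⟨isPositive_of_tendsto hpos hlim, F, fun n => α (n + 1), hpos, fun n => hα _, hmono,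
    fun n => Dominated.trans (fun a => ?_) (hdom (n + 1)), hlim⟩
  simp only [F, sub_sub_cancel]
  rw [LinearMap.smul_apply, vectorFunctional_star_mul_self, smul_eq_mul, ← Complex.ofReal_mul]
  have := hs n
  exact Complex.zero_le_real.2 (by positivity)

end AbsCont

/-! ### Non-uniqueness -/

/-- If `f ≪ g` then `f = f + 0` is the Lebesgue decomposition of `f` with respect to `g`. -/
theorem AbsCont.isLebesgueDecomposition {A : Type*} [NonUnitalCStarAlgebra A] {f g : A →ₗ[ℂ] ℂ}
    (hf : IsPositive f) (hfg : AbsCont f g) : IsLebesgueDecomposition f g f 0 := by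
  have h0 (h : A →ₗ[ℂ] ℂ) : Singular 0 h := fun p hp hp0 _ =>
    eq_zero_of_forall_star_mul_self fun a => le_antisymm (by simpa using hp0 a) (hp a)
  exact ⟨⟨⟨hf, fun a => by simp, hfg⟩, fun _ _ h _ => h⟩, fun a => by simp, by simp, h0 g, h0 f⟩

theorem exists_orthonormal_sequence {H : Type*} [NormedAddCommGroup H] [InnerProductSpace ℂ H]
    [CompleteSpace H] (hH : ¬ FiniteDimensional ℂ H) : ∃ e : ℕ → H, Orthonormal ℂ e := by
  obtain ⟨w, b, -⟩ := exists_hilbertBasis ℂ H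
  have : Infinite w := by
    by_contra hw
    rw [not_infinite_iff_finite] at hw
    have := Fintype.ofFinite w
    exact hH b.toOrthonormalBasis.toBasis.finiteDimensional_of_finite
  exact ⟨_, b.orthonormal.comp _ (Infinite.natEmbedding w).injective⟩

theorem exists_lp_apply_eq {H : Type*} [NormedAddCommGroup H] [InnerProductSpace ℂ H] {e : ℕ → H}
    (he : Orthonormal ℂ e) {c : ℕ → ℝ} (hc : Summable fun n => c n ^ 2) :
    ∃ ξ : lp (fun _ : ℕ => H) 2, ∀ n, ξ n = (c n : ℂ) • e n := by
  refine ⟨⟨fun n => (c n : ℂ) • e n, memℓp_gen ?_⟩, fun n => rfl⟩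
  simpa [norm_smul, he.1] using hc

end LebesgueDecomp

theorem mainTheorem3 {A : Type*} [NonUnitalCStarAlgebra A]
    {H : Type*} [NormedAddCommGroup H] [InnerProductSpace ℂ H] [CompleteSpace H]
    (π : A →⋆ₙₐ[ℂ] (H →L[ℂ] H)) (hπ : LebesgueDecomp.IsIrreducibleRep π)
    (hH : ¬ FiniteDimensional ℂ H) :
    ¬ LebesgueDecomp.LebesgueDecompositionUnique A := by
  open LebesgueDecomp in
  intro huniq
  obtain ⟨e, he⟩ := exists_orthonormal_sequence hH
  let δ : ℕ → ℝ := fun n => √((1 / 2) ^ (n + 1))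
  have hδ (n) : 0 < δ n := by positivity
  have hδ2 (n) : δ n ^ 2 = (1 / 2) ^ (n + 1) := Real.sq_sqrt (by positivity)
  have h1 : HasSum (fun n => δ n ^ 2) 1 := by
    simp only [hδ2, pow_succ]
    simpa using hasSum_geometric_two.mul_right (1 / 2 : ℝ)
  obtain ⟨ξ, hξ⟩ := exists_lp_apply_eq he h1.summable
  obtain ⟨η, hη⟩ := exists_lp_apply_eq (c := fun n => δ n ^ 2) he (by
    simp only [hδ2, ← pow_mul]
    refine Summable.comp_injective (i := fun n => (n + 1) * 2) summable_geometric_two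
      fun m n h => ?_
    simpa using h)
  have hηξ (n) : η n = (δ n : ℂ) • ξ n := by
    rw [hη, hξ, smul_smul, ← Complex.ofReal_mul, ← sq]
  obtain ⟨v, hv⟩ : Summable fun n => η n :=
    Summable.of_norm (by simpa [hη, norm_smul, he.1] using h1.summable)
  obtain ⟨hTpos, hTac⟩ := isPositive_and_absCont_sub π hδ hηξ h1 hv
  have hsing := hπ.singular_vectorFunctional he
    (fun n => Complex.ofReal_ne_zero.2 (pow_pos (hδ n) 2).ne') hη hv
  have hpos := isPositive_vectorFunctional (amplify π) ξ
  have hv0 := (huniq _ _ hpos (isPositive_vectorFunctional (amplify π) η) _ _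
    ((absCont_vectorFunctional_amplify π hδ hηξ).isLebesgueDecomposition hpos) _ _ hTpos
    (isPositive_vectorFunctional π v) (sub_add_cancel _ _).symm hTac hsing).2
  have hv' : v = 0 := hπ.eq_zero_of_forall fun a => by
    have := vectorFunctional_star_mul_self π v a
    rw [hv0, LinearMap.zero_apply, eq_comm, Complex.ofReal_eq_zero] at this
    simpa using this
  have h0 := he.inner_eq_of_hasSum (by simpa only [hη] using hv) 0
  rw [hv', inner_zero_right, eq_comm, Complex.ofReal_eq_zero] at h0
  exact (pow_pos (hδ 0) 2).ne' h0
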